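/- Let $n\in\mathbb N$ and let $L,R$ be disjoint sets with $|L|=|R|=n$. In the bipartite perfect matching problem ($\mathsf{BPM}$) the input is a bipartite graph $G=(L\cup R,E)$, $E\subseteq L\times R$, and one has to decide whether $G$ has a perfect matching. The algorithm knows $L$ and $R$ and accesses $E$ only through adaptive queries. A query is a set $S\subseteq L\times R$ chosen by the algorithm; its answer is - in the OR-query model: whether $|S\cap E|\ge 1$; - in the AND-query model: whether $S\subseteq E$; - in the XOR-query model: whether $|S\cap E|$ is odd. A deterministic query algorithm is a decision tree; it solves $\mathsf{BPM}$ if its output is correct on every input. A randomized query algorithm is a probability distribution over deterministic ones; it solves $\mathsf{BPM}$ with error $\varepsilon$ if on every input its output is wrong with probability at most $\varepsilon$. Then there is an absolute constant $c>0$, and for every $\varepsilon\in[0,\tfrac12)$ a constant $c_\varepsilon>0$, such that for all sufficiently large $n$ (depending on $\varepsilon$ in the randomized case): 1. every deterministic OR-query algorithm solving $\mathsf{BPM}$ asks at least $c\,n\log n$ queries on some input; 2. every deterministic AND-query algorithm solving $\mathsf{BPM}$ asks at least $c\,n^2$ queries on some input; and every randomized AND-query algorithm solving $\mathsf{BPM}$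 with error $\varepsilon$ asks at least $c_\varepsilon\,n^2$ queries in expectation on some input (hence also in the worst case); 3. every deterministic XOR-query algorithm solving $\mathsf{BPM}$ asks at least $c\,n^2$ queries on some input. -/

import Mathlib

open Filter

/-- A potential edge of a bipartite graph whose two sides `L` and `R` have `n` vertices each:
a pair in `L × R`. -/
abbrev PotentialEdge (n : ℕ) : Type := Fin n × Fin n

/-- The bipartite graph on `L ∪ R` (the disjoint union of two copies of `Fin n`) whose edges join
the left vertex `e.1` to the right vertex `e.2`, for `e ∈ E`. -/
def bipartiteGraph {n : ℕ} (E : Finset (PotentialEdge n)) : SimpleGraph (Fin n ⊕ Fin n) :=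
  SimpleGraph.fromRel fun a b => ∃ e ∈ E, a = Sum.inl e.1 ∧ b = Sum.inr e.2

/-- The bipartite perfect matching predicate. -/
def HasBPM {n : ℕ} (E : Finset (PotentialEdge n)) : Prop :=
  ∃ M : (bipartiteGraph E).Subgraph, M.IsPerfectMatching

/-- A query model: how a query `S ⊆ L × R` is answered on the graph with edge set `E`
(`answer S E`, query first). -/
abbrev QueryModel : Type :=
  (n : ℕ) → Finset (PotentialEdge n) → Finset (PotentialEdge n) → Bool

/-- OR-query: is `|S ∩ E| ≥ 1`? -/
def orQuery : QueryModel := fun _ S E => decide (1 ≤ (S ∩ E).card)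

/-- AND-query: is `S ⊆ E`? -/
def andQuery : QueryModel := fun _ S E => decide (S ⊆ E)

/-- XOR-query: is `|S ∩ E|` odd? -/
def xorQuery : QueryModel := fun _ S E => decide (Odd (S ∩ E).card)

/-- A deterministic (adaptive) query algorithm with Boolean output, as a decision tree: it either
stops with an output, or asks a query `S` and continues according to the answer received. -/
inductive QueryAlg (n : ℕ) : Type
  | output (b : Bool) : QueryAlg n
  | ask (S : Finset (PotentialEdge n)) (ifNo ifYes : QueryAlg n) : QueryAlg n

namespace QueryAlg

/-- The output on the graph with edge set `E`, queries being answered according to `Q`. -/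
def run {n : ℕ} (Q : QueryModel) (E : Finset (PotentialEdge n)) : QueryAlg n → Bool
  | output b => b
  | ask S ifNo ifYes => if Q n S E = true then run Q E ifYes else run Q E ifNo

/-- The number of queries asked on the graph with edge set `E`. -/
def numQueries {n : ℕ} (Q : QueryModel) (E : Finset (PotentialEdge n)) : QueryAlg n → ℕ
  | output _ => 0
  | ask S ifNo ifYes =>
      1 + if Q n S E = true then numQueries Q E ifYes else numQueries Q E ifNo

/-- The output on the graph with edge set `E` is correct for bipartite perfect matching. -/
def CorrectOn {n : ℕ} (Q : QueryModel) (A : QueryAlg n) (E : Finset (PotentialEdge n)) : Prop :=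
  A.run Q E = true ↔ HasBPM E

/-- A deterministic algorithm solves bipartite perfect matching if it is correct on every graph. -/
def SolvesBPM {n : ℕ} (Q : QueryModel) (A : QueryAlg n) : Prop :=
  ∀ E : Finset (PotentialEdge n), A.CorrectOn Q E

end QueryAlg

/-- A randomized query algorithm: a probability distribution on deterministic algorithms. -/
abbrev RandQueryAlg (n : ℕ) : Type := PMF (QueryAlg n)

namespace RandQueryAlg

/-- The probability that the output on the graph with edge set `E` is wrong. -/
noncomputable def errorProb {n : ℕ} (Q : QueryModel) (A : RandQueryAlg n)
    (E : Finset (PotentialEdge n)) : ENNReal :=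
  PMF.toOuterMeasure A {D | ¬ D.CorrectOn Q E}

/-- On every graph the output is wrong with probability at most `ε`. -/
def SolvesBPMWithError {n : ℕ} (Q : QueryModel) (ε : ℝ) (A : RandQueryAlg n) : Prop :=
  ∀ E : Finset (PotentialEdge n), errorProb Q A E ≤ ENNReal.ofReal ε

/-- The expected number of queries (possibly infinite) asked on the graph with edge set `E`. -/
noncomputable def expectedQueries {n : ℕ} (Q : QueryModel) (A : RandQueryAlg n)
    (E : Finset (PotentialEdge n)) : ENNReal :=
  ∑' D : QueryAlg n, A D * (D.numQueries Q E : ENNReal)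

end RandQueryAlg

/-!
Two ideas give the four bounds.

For AND- and XOR-queries, let `|L₁| + |R₁| = n + 1` and put in every potential edge outside the
block `L₁ × R₁`. By Hall's condition the empty block admits no perfect matching, whereas any single
edge of the block completes one, so on these inputs the problem is the disjunction of the
`|L₁| |R₁| = Ω(n ^ 2)` block edges. When at most one block edge is present, an AND-query can tell
the empty block from at most one of its edges; hence the expected number of queries on the empty
block is at least the sum over the block edges of the probability of testing that edge, and each of
these is at least `1 - 2ε` (`card_hallBlock_le_errors_add_numQueries`). Fewer parities than block
edges all vanish on some nonempty subset of the block (`exists_nonempty_even_inter`), and adding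
that subset to the empty block goes unnoticed by the corresponding XOR-queries.

For OR-queries, the inputs are the `n!` graphs that are single perfect matchings, and the point is
that a leaf of a correct tree of depth `d` is reached by few of them. A leaf gives a set `Z` of
absent edges and sets `W`, disjoint from `Z`, each known to contain an edge. If the leaf accepts,
then every Hall block must contain one of the at most `d` sets `W`, since otherwise deleting that
block together with `Z` from the complete graph would lead to the same leaf. Among these sets there
is always a small one: once some values of a permutation `σ` are known, the subsets of the free
vertices index a cube of Hall blocks, which the conditions `W ⊆ L₁ × R₁` cover, and a cover of a
cube by `d < 2 ^ s` subcubes has one of codimension less than `s` (`exists_narrow_of_cover`). An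
edge of `σ` in that `W` has at most `s ^ 2` possibilities and is new. Hence at most `(s ^ 2) ^ n`
permutations reach the leaf (`card_perms_hitting_le`), so `n! ≤ 2 ^ d * (s ^ 2) ^ n` with
`s = O(log n)`, which forces `d = Ω(n log n)`.
-/

open Equiv Finset

/-! ### Perfect matchings as permutations -/

theorem hasBPM_iff_exists_perm {n : ℕ} (E : Finset (PotentialEdge n)) :
    HasBPM E ↔ ∃ σ : Perm (Fin n), ∀ i, (i, σ i) ∈ E := by
  have adj_iff : ∀ i j : Fin n,
      (bipartiteGraph E).Adj (Sum.inl i) (Sum.inr j) ↔ (i, j) ∈ E := by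
    intro i j
    simp [bipartiteGraph]
  have not_adj : ∀ i j : Fin n, ¬ (bipartiteGraph E).Adj (Sum.inl i) (Sum.inl j) := by
    intro i j
    simp [bipartiteGraph]
  constructor
  · rintro ⟨M, hM, hspan⟩
    have partner : ∀ i : Fin n, ∃ j : Fin n, M.Adj (Sum.inl i) (Sum.inr j) := by
      intro i
      obtain ⟨w, hw, -⟩ := hM (hspan (Sum.inl i))
      cases w with
      | inl j => exact absurd hw.adj_sub (not_adj i j)
      | inr j => exact ⟨j, hw⟩
    choose f hf using partner
    have hinj : Function.Injective f := by
      intro i i' h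
      obtain ⟨w, -, hw⟩ := hM (hspan (Sum.inr (f i)))
      have h1 := hw _ (hf i).symm
      have h2 := hw (Sum.inl i') (by simpa [h] using (hf i').symm)
      exact Sum.inl_injective (h1.trans h2.symm)
    refine ⟨Equiv.ofBijective f (Finite.injective_iff_bijective.1 hinj), fun i => ?_⟩
    exact (adj_iff i (f i)).1 (hf i).adj_sub
  · rintro ⟨σ, hσ⟩
    let M : (bipartiteGraph E).Subgraph :=
      { verts := Set.univ
        Adj := fun a b => (∃ i, a = Sum.inl i ∧ b = Sum.inr (σ i)) ∨
          (∃ i, b = Sum.inl i ∧ a = Sum.inr (σ i))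
        adj_sub := by
          rintro a b (⟨i, rfl, rfl⟩ | ⟨i, rfl, rfl⟩)
          · exact (adj_iff _ _).2 (hσ i)
          · exact ((adj_iff _ _).2 (hσ i)).symm
        edge_vert := fun _ => Set.mem_univ _
        symm := by
          constructor
          rintro a b (h | h)
          · exact Or.inr h
          · exact Or.inl h }
    refine ⟨M, ?_, fun _ => Set.mem_univ _⟩
    rintro (i | j) -
    · refine ⟨Sum.inr (σ i), Or.inl ⟨i, rfl, rfl⟩, ?_⟩
      rintro y (⟨k, hk, rfl⟩ | ⟨k, -, hk⟩)
      · rw [Sum.inl_injective hk]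
      · exact absurd hk (by simp)
    · refine ⟨Sum.inl (σ.symm j), Or.inr ⟨σ.symm j, rfl, by simp⟩, ?_⟩
      rintro y (⟨k, hk, -⟩ | ⟨k, rfl, hk⟩)
      · exact absurd hk (by simp)
      · rw [Sum.inr_injective hk]
        simp

/-- The easy direction of Hall's theorem: an empty `L₁ × R₁` block with `|L₁| + |R₁| = n + 1`
rules out a perfect matching. -/
theorem not_hasBPM_of_disjoint_product {n : ℕ} {E : Finset (PotentialEdge n)}
    {L₁ R₁ : Finset (Fin n)} (hcard : L₁.card + R₁.card = n + 1)
    (hE : ∀ e ∈ E, e ∉ L₁ ×ˢ R₁) : ¬ HasBPM E := by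
  rw [hasBPM_iff_exists_perm]
  rintro ⟨σ, hσ⟩
  have hsub : L₁.map σ.toEmbedding ⊆ R₁ᶜ := by
    intro j hj
    obtain ⟨i, hi, rfl⟩ := Finset.mem_map.1 hj
    have := hE _ (hσ i)
    simp only [Finset.mem_product, not_and] at this
    simpa using this hi
  have hle := Finset.card_le_card hsub
  rw [Finset.card_map, Finset.card_compl, Fintype.card_fin] at hle
  have := Finset.card_le_univ R₁
  rw [Fintype.card_fin] at this
  omega

/-! ### The queries asked on an input -/

namespace QueryAlg

/-- The list of queries asked on the graph with edge set `E`, in order. -/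
def asked {n : ℕ} (Q : QueryModel) (E : Finset (PotentialEdge n)) :
    QueryAlg n → List (Finset (PotentialEdge n))
  | output _ => []
  | ask S ifNo ifYes => S :: if Q n S E = true then asked Q E ifYes else asked Q E ifNo

theorem length_asked {n : ℕ} (Q : QueryModel) (E : Finset (PotentialEdge n)) (A : QueryAlg n) :
    (A.asked Q E).length = A.numQueries Q E := by
  induction A with
  | output b => rfl
  | ask S l r hl hr =>
    by_cases h : Q n S E = true
    · simp [asked, numQueries, h, hr, add_comm]
    · simp [asked, numQueries, h, hl, add_comm]

theorem run_eq_of_agree {n : ℕ} {Q : QueryModel} {E E' : Finset (PotentialEdge n)}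
    (A : QueryAlg n) (h : ∀ S ∈ A.asked Q E, Q n S E' = Q n S E) :
    A.run Q E' = A.run Q E := by
  induction A with
  | output b => rfl
  | ask S l r hl hr =>
    have hS := h S (by simp [asked])
    by_cases hE : Q n S E = true
    · simp only [run, hS, hE, if_true]
      exact hr fun T hT => h T (by simp [asked, hE, hT])
    · simp only [run, hS, hE]
      exact hl fun T hT => h T (by simp [asked, hE, hT])

/-- A tree of depth at most `d` has at most `2 ^ d` leaves: if at most `B` members of a family of
inputs are indistinguishable from any given member, then the family has at most `2 ^ d * B`
members. -/
theorem card_le_two_pow_mul {n : ℕ} (Q : QueryModel) (A : QueryAlg n) (B : ℕ) :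
    ∀ (d : ℕ) (F : Finset (Finset (PotentialEdge n))),
      (∀ E ∈ F, A.numQueries Q E ≤ d) →
      (∀ E₀ ∈ F, (F.filter fun E => ∀ S ∈ A.asked Q E₀, Q n S E = Q n S E₀).card ≤ B) →
      F.card ≤ 2 ^ d * B := by
  induction A with
  | output b =>
    intro d F _ hB
    rcases F.eq_empty_or_nonempty with rfl | ⟨E₀, hE₀⟩
    · simp
    · have := hB E₀ hE₀
      simp only [asked, List.not_mem_nil, false_imp_iff, implies_true, Finset.filter_true] at this
      exact this.trans (Nat.le_mul_of_pos_left _ (by positivity))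
  | ask S l r hl hr =>
    intro d F hd hB
    rcases F.eq_empty_or_nonempty with rfl | ⟨E₁, hE₁⟩
    · simp
    obtain ⟨d, rfl⟩ : ∃ k, d = k + 1 := by
      have := hd E₁ hE₁
      simp only [numQueries] at this
      exact ⟨d - 1, by omega⟩
    have hyes : (F.filter fun E => Q n S E = true).card ≤ 2 ^ d * B := by
      refine hr d _ (fun E hE => ?_) (fun E₀ hE₀ => ?_)
      · obtain ⟨hE, hS⟩ := Finset.mem_filter.1 hE
        have := hd E hE
        simp only [numQueries, hS, if_true] at this
        omega
      · obtain ⟨hE₀, hS⟩ := Finset.mem_filter.1 hE₀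
        refine le_trans (Finset.card_le_card fun E hE => ?_) (hB E₀ hE₀)
        simp only [Finset.mem_filter] at hE ⊢
        refine ⟨hE.1.1, ?_⟩
        simpa [asked, hS, hE.1.2] using hE.2
    have hno : (F.filter fun E => ¬ Q n S E = true).card ≤ 2 ^ d * B := by
      refine hl d _ (fun E hE => ?_) (fun E₀ hE₀ => ?_)
      · obtain ⟨hE, hS⟩ := Finset.mem_filter.1 hE
        have := hd E hE
        simp only [numQueries, hS] at this
        simp at this
        omega
      · obtain ⟨hE₀, hS⟩ := Finset.mem_filter.1 hE₀
        refine le_trans (Finset.card_le_card fun E hE => ?_) (hB E₀ hE₀)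
        simp only [Finset.mem_filter] at hE ⊢
        refine ⟨hE.1.1, ?_⟩
        have h1 : Q n S E = false := by simpa using hE.1.2
        have h2 : Q n S E₀ = false := by simpa using hS
        simpa [asked, h1, h2] using hE.2
    have := Finset.card_filter_add_card_filter_not (s := F) (fun E => Q n S E = true)
    rw [pow_succ]
    linarith

end QueryAlg

/-! ### A block on which matching is disjunction -/

/-- The block `L₁ × R₁` with `L₁ = {i ≤ m}` and `R₁ = {j ≥ m}`; here `|L₁| + |R₁| = n + 1`, so that
leaving it empty just violates Hall's condition. -/
def hallBlock {n : ℕ} (m : Fin n) : Finset (PotentialEdge n) := Finset.Iic m ×ˢ Finset.Ici m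

theorem card_hallBlock {n : ℕ} (m : Fin n) : (hallBlock m).card = (m + 1) * (n - m) := by
  simp [hallBlock, Fin.card_Iic, Fin.card_Ici]

theorem not_hasBPM_compl_hallBlock {n : ℕ} (m : Fin n) : ¬ HasBPM (hallBlock m)ᶜ := by
  refine not_hasBPM_of_disjoint_product (L₁ := Finset.Iic m) (R₁ := Finset.Ici m) ?_ ?_
  · rw [Fin.card_Iic, Fin.card_Ici]
    omega
  · intro e he
    simpa [hallBlock] using he

theorem hasBPM_of_compl_hallBlock_subset {n : ℕ} {m : Fin n} {E : Finset (PotentialEdge n)}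
    (hE : (hallBlock m)ᶜ ⊆ E) {e : PotentialEdge n} (he : e ∈ hallBlock m) (heE : e ∈ E) :
    HasBPM E := by
  rw [hasBPM_iff_exists_perm]
  obtain ⟨a, b⟩ := e
  simp only [hallBlock, Finset.mem_product, Finset.mem_Iic, Finset.mem_Ici] at he
  -- The identity meets the block in `(m, m)` only; the two swaps move that edge to `(a, b)`.
  refine ⟨swap m b * swap a m, fun i => ?_⟩
  rw [Perm.mul_apply]
  by_cases hia : i = a
  · subst hia
    simpa using heE
  · apply hE
    simp only [hallBlock, Finset.mem_compl, Finset.mem_product, Finset.mem_Iic, Finset.mem_Ici,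
      not_and, not_le]
    intro him
    by_cases hm : i = m
    · subst hm
      have ham : a < i := lt_of_le_of_ne he.1 (Ne.symm hia)
      rw [swap_apply_right, swap_apply_of_ne_of_ne ham.ne (ham.trans_le he.2).ne]
      exact ham
    · have him' : i < m := lt_of_le_of_ne him hm
      rw [swap_apply_of_ne_of_ne hia hm, swap_apply_of_ne_of_ne hm (him'.trans_le he.2).ne]
      exact him'

/-- Splitting in the middle makes the block quadratically large. -/
theorem exists_large_hallBlock {n : ℕ} (hn : 1 ≤ n) :
    ∃ m : Fin n, (1 / 4 : ℝ) * (n : ℝ) ^ 2 ≤ ((hallBlock m).card : ℝ) := by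
  refine ⟨⟨n / 2, by omega⟩, ?_⟩
  rw [card_hallBlock]
  have h : n * n ≤ 4 * ((n / 2 + 1) * (n - n / 2)) := by
    have h1 : n ≤ 2 * (n / 2 + 1) := by omega
    have h2 : n ≤ 2 * (n - n / 2) := by omega
    calc n * n ≤ (2 * (n / 2 + 1)) * (2 * (n - n / 2)) := Nat.mul_le_mul h1 h2
      _ = _ := by ring
  have h' : (n : ℝ) * n ≤ 4 * (((n / 2 + 1) * (n - n / 2) : ℕ) : ℝ) := by exact_mod_cast h
  rw [sq]
  linarith

/-! ### AND-queries -/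

/-- On graphs containing at most one edge of the block, an AND-query tests at most one edge of it. -/
theorem inter_hallBlock_eq_singleton {n : ℕ} {m : Fin n} {e : PotentialEdge n}
    {S : Finset (PotentialEdge n)}
    (h : andQuery n S (insert e (hallBlock m)ᶜ) ≠ andQuery n S (hallBlock m)ᶜ) :
    S ∩ hallBlock m = {e} := by
  have hsub : S ⊆ insert e (hallBlock m)ᶜ ∧ ¬ S ⊆ (hallBlock m)ᶜ := by
    by_cases h2 : S ⊆ (hallBlock m)ᶜ
    · exact absurd (by simp [andQuery, h2, h2.trans (Finset.subset_insert _ _)]) h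
    · by_cases h1 : S ⊆ insert e (hallBlock m)ᶜ
      · exact ⟨h1, h2⟩
      · exact absurd (by simp [andQuery, h1, h2]) h
  obtain ⟨h1, h2⟩ := hsub
  refine Finset.eq_singleton_iff_nonempty_unique_mem.2 ⟨?_, fun f hf => ?_⟩
  · obtain ⟨f, hf, hf'⟩ := Finset.not_subset.1 h2
    exact ⟨f, Finset.mem_inter.2 ⟨hf, by simpa using hf'⟩⟩
  · obtain ⟨hfS, hfB⟩ := Finset.mem_inter.1 hf
    rcases Finset.mem_insert.1 (h1 hfS) with h | h
    · exact h
    · exact absurd hfB (by simpa using h)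

open Classical in
/-- Each edge of the block that is not tested individually on the empty block costs an error there
or on the graph with that edge added. -/
theorem card_hallBlock_le_errors_add_numQueries {n : ℕ} (m : Fin n) (A : QueryAlg n) :
    (hallBlock m).card ≤
      ∑ e ∈ hallBlock m, ((if ¬ A.CorrectOn andQuery (hallBlock m)ᶜ then 1 else 0) +
        (if ¬ A.CorrectOn andQuery (insert e (hallBlock m)ᶜ) then 1 else 0)) +
      A.numQueries andQuery (hallBlock m)ᶜ := by
  set E₀ := (hallBlock m)ᶜ with hE₀
  set T := ((A.asked andQuery E₀).toFinset.image fun S => S ∩ hallBlock m) with hT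
  have hTcard : T.card ≤ A.numQueries andQuery E₀ := by
    rw [← QueryAlg.length_asked]
    exact Finset.card_image_le.trans (List.toFinset_card_le _)
  have hpin : ((hallBlock m).filter fun e => {e} ∈ T).card ≤ T.card :=
    Finset.card_le_card_of_injOn (fun e => {e}) (fun e he => (Finset.mem_filter.1 he).2)
      (fun _ _ _ _ h => Finset.singleton_injective h)
  have hpoint : ∀ e ∈ hallBlock m, 1 ≤ ((if ¬ A.CorrectOn andQuery E₀ then 1 else 0) +
      (if ¬ A.CorrectOn andQuery (insert e E₀) then 1 else 0)) +
      (if {e} ∈ T then 1 else 0) := by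
    intro e he
    by_contra hlt
    have h0 : A.CorrectOn andQuery E₀ := by
      by_contra h
      simp [h] at hlt
    have h1 : A.CorrectOn andQuery (insert e E₀) := by
      by_contra h
      simp [h] at hlt
    have h2 : {e} ∉ T := by
      intro h
      simp [h] at hlt
    have hrun : A.run andQuery (insert e E₀) = A.run andQuery E₀ := by
      refine A.run_eq_of_agree fun S hS => ?_
      by_contra hne
      exact h2 (Finset.mem_image.2 ⟨S, List.mem_toFinset.2 hS,
        inter_hallBlock_eq_singleton hne⟩)
    have hyes := h1.2 (hasBPM_of_compl_hallBlock_subset (Finset.subset_insert _ _) he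
      (Finset.mem_insert_self _ _))
    exact not_hasBPM_compl_hallBlock m (h0.1 (hrun ▸ hyes))
  have hsum := Finset.sum_le_sum hpoint
  rw [Finset.sum_add_distrib, ← Finset.card_filter (fun e => {e} ∈ T)] at hsum
  simp only [Finset.sum_const, smul_eq_mul, mul_one] at hsum
  omega

theorem card_hallBlock_le_numQueries_andQuery {n : ℕ} (m : Fin n) {A : QueryAlg n}
    (hA : A.SolvesBPM andQuery) :
    (hallBlock m).card ≤ A.numQueries andQuery (hallBlock m)ᶜ := by
  classical
  simpa [hA _] using card_hallBlock_le_errors_add_numQueries m A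

theorem card_hallBlock_le_expectedQueries_andQuery {n : ℕ} (m : Fin n) {ε : ℝ} (hε : 0 ≤ ε)
    {A : RandQueryAlg n} (hA : RandQueryAlg.SolvesBPMWithError andQuery ε A) :
    ENNReal.ofReal ((1 - 2 * ε) * (hallBlock m).card) ≤
      RandQueryAlg.expectedQueries andQuery A (hallBlock m)ᶜ := by
  classical
  set E₀ := (hallBlock m)ᶜ with hE₀
  set N := (hallBlock m).card with hN
  have herr : ∀ E : Finset (PotentialEdge n),
      ∑' D, A D * (if ¬ D.CorrectOn andQuery E then 1 else 0) ≤ ENNReal.ofReal ε := by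
    intro E
    refine le_trans (le_of_eq ?_) (hA E)
    rw [RandQueryAlg.errorProb, PMF.toOuterMeasure_apply]
    refine tsum_congr fun D => ?_
    by_cases h : D.CorrectOn andQuery E <;> simp [Set.indicator, h]
  have hpoint : ∀ D : QueryAlg n, (N : ENNReal) ≤
      ∑ e ∈ hallBlock m, ((if ¬ D.CorrectOn andQuery E₀ then 1 else 0) +
        (if ¬ D.CorrectOn andQuery (insert e E₀) then 1 else 0)) +
      (D.numQueries andQuery E₀ : ENNReal) := by
    intro D
    exact_mod_cast card_hallBlock_le_errors_add_numQueries m D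
  have hmain : (N : ENNReal) ≤ N * (ENNReal.ofReal ε + ENNReal.ofReal ε) +
      RandQueryAlg.expectedQueries andQuery A E₀ := by
    calc (N : ENNReal) = ∑' D, A D * N := by rw [ENNReal.tsum_mul_right, A.tsum_coe, one_mul]
      _ ≤ ∑' D, A D * (∑ e ∈ hallBlock m, ((if ¬ D.CorrectOn andQuery E₀ then 1 else 0) +
            (if ¬ D.CorrectOn andQuery (insert e E₀) then 1 else 0)) +
            (D.numQueries andQuery E₀ : ENNReal)) :=
          ENNReal.tsum_le_tsum fun D => mul_le_mul_right (hpoint D) _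
      _ = ∑ e ∈ hallBlock m, (∑' D, A D * (if ¬ D.CorrectOn andQuery E₀ then 1 else 0) +
            ∑' D, A D * (if ¬ D.CorrectOn andQuery (insert e E₀) then 1 else 0)) +
            RandQueryAlg.expectedQueries andQuery A E₀ := by
          simp_rw [mul_add, ENNReal.tsum_add, Finset.mul_sum, mul_add]
          rw [Summable.tsum_finsetSum fun _ _ => ENNReal.summable]
          simp_rw [ENNReal.tsum_add]
          rfl
      _ ≤ _ := by
          refine add_le_add_left ?_ _
          refine (Finset.sum_le_sum fun e _ => add_le_add (herr E₀) (herr (insert e E₀))).trans ?_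
          rw [Finset.sum_const, nsmul_eq_mul]
  have hsplit : (N : ENNReal) * (ENNReal.ofReal ε + ENNReal.ofReal ε) =
      ENNReal.ofReal (N * (ε + ε)) := by
    rw [ENNReal.ofReal_mul (by positivity), ENNReal.ofReal_add hε hε, ENNReal.ofReal_natCast]
  rw [hsplit, ← ENNReal.ofReal_natCast] at hmain
  have hsub := tsub_le_iff_left.2 hmain
  rw [← ENNReal.ofReal_sub _ (by positivity)] at hsub
  rwa [show (N : ℝ) - N * (ε + ε) = (1 - 2 * ε) * N by ring] at hsub

/-! ### XOR-queries -/

/-- Fewer than `|B|` parities cannot separate all subsets of `B`: some nonempty subset meets each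
of the given sets in an even number of points. -/
theorem exists_nonempty_even_inter {α : Type*} [DecidableEq α] (B : Finset α)
    (l : List (Finset α)) (hl : l.length < B.card) :
    ∃ F ⊆ B, F.Nonempty ∧ ∀ S ∈ l, Even (S ∩ F).card := by
  obtain ⟨F, hF, G, hG, hne, heq⟩ := Finset.exists_ne_map_eq_of_card_lt_of_maps_to
    (s := B.powerset) (t := (Finset.univ : Finset (Fin l.length → Bool)))
    (f := fun F i => decide (Even (l[i] ∩ F).card))
    (by simpa using Nat.pow_lt_pow_right (by norm_num : 1 < 2) hl)
    (fun _ _ => Finset.mem_coe.2 (Finset.mem_univ _))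
  refine ⟨symmDiff F G, ?_, ?_, fun S hS => ?_⟩
  · exact (symmDiff_le_sup (a := F) (b := G)).trans
      (Finset.union_subset (Finset.mem_powerset.1 hF) (Finset.mem_powerset.1 hG))
  · rw [Finset.nonempty_iff_ne_empty]
    exact fun h => hne (symmDiff_eq_bot.1 h)
  · obtain ⟨i, hi, rfl⟩ := List.getElem_of_mem hS
    have hpar : Even (l[i] ∩ F).card ↔ Even (l[i] ∩ G).card := by
      simpa using congrFun heq ⟨i, hi⟩
    have h1 : l[i] ∩ symmDiff F G = (l[i] ∩ F) \ G ∪ (l[i] ∩ G) \ F := by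
      ext x
      simp only [Finset.mem_inter, Finset.mem_symmDiff, Finset.mem_union, Finset.mem_sdiff]
      tauto
    have h2 : Disjoint ((l[i] ∩ F) \ G) ((l[i] ∩ G) \ F) := by
      rw [Finset.disjoint_left]
      simp only [Finset.mem_inter, Finset.mem_sdiff]
      tauto
    have h3 := Finset.card_sdiff_add_card_inter (l[i] ∩ F) G
    have h4 := Finset.card_sdiff_add_card_inter (l[i] ∩ G) F
    rw [Finset.inter_right_comm] at h4
    rw [h1, Finset.card_union_of_disjoint h2]
    rw [← h3, ← h4] at hpar
    simp only [Nat.even_add] at hpar ⊢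
    tauto

theorem card_hallBlock_le_numQueries_xorQuery {n : ℕ} (m : Fin n) {A : QueryAlg n}
    (hA : A.SolvesBPM xorQuery) :
    (hallBlock m).card ≤ A.numQueries xorQuery (hallBlock m)ᶜ := by
  by_contra hlt
  rw [not_le, ← QueryAlg.length_asked] at hlt
  obtain ⟨F, hFB, ⟨e, he⟩, hF⟩ := exists_nonempty_even_inter _ _ hlt
  have hdisj : Disjoint (hallBlock m)ᶜ F :=
    disjoint_compl_left.mono_right hFB
  have hrun : A.run xorQuery ((hallBlock m)ᶜ ∪ F) = A.run xorQuery (hallBlock m)ᶜ := by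
    refine A.run_eq_of_agree fun S hS => ?_
    have hd : Disjoint (S ∩ (hallBlock m)ᶜ) (S ∩ F) :=
      hdisj.mono Finset.inter_subset_right Finset.inter_subset_right
    simp only [xorQuery]
    rw [Finset.inter_union_distrib_left, Finset.card_union_of_disjoint hd]
    have := hF S hS
    simp [Nat.odd_add, this]
  have hyes := (hA _).2 (hasBPM_of_compl_hallBlock_subset Finset.subset_union_left (hFB he)
    (Finset.mem_union_right _ he))
  exact not_hasBPM_compl_hallBlock m ((hA _).1 (hrun ▸ hyes))

/-! ### Permutations hitting a small family of edge sets -/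

/-- A disjunction of fewer than `2 ^ s` conjunctions that covers the cube of all subsets of `V` has
a conjunction of fewer than `s` literals. The conjunction `w` is any relation `r w U` that forces
`P w ⊆ U` and `N w ∩ U = ∅`. -/
theorem exists_narrow_of_cover {ι α : Type*} [DecidableEq α] {s : ℕ} (𝒲 : Finset ι)
    (V : Finset α) (P N : ι → Finset α) (r : ι → Finset α → Prop) (hN : ∀ w, N w ⊆ V)
    (hr : ∀ w ∈ 𝒲, ∀ U ⊆ V, r w U → P w ⊆ U ∧ U ⊆ V \ N w)
    (hcover : ∀ U ⊆ V, ∃ w ∈ 𝒲, r w U) (hs : 𝒲.card < 2 ^ s) :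
    ∃ w ∈ 𝒲, ∃ U ⊆ V, r w U ∧ (P w).card + (N w).card < s := by
  classical
  by_contra! hwide
  have hcount : ∀ w ∈ 𝒲, (V.powerset.filter (r w)).card * 2 ^ s ≤ 2 ^ V.card := by
    intro w hw
    rcases (V.powerset.filter (r w)).eq_empty_or_nonempty with h | ⟨U, hU⟩
    · simp [h]
    · obtain ⟨hUV, hrU⟩ := Finset.mem_filter.1 hU
      rw [Finset.mem_powerset] at hUV
      have hlong := hwide w hw U hUV hrU
      obtain ⟨hPU, hUN⟩ := hr w hw U hUV hrU
      have hsub : V.powerset.filter (r w) ⊆ Finset.Icc (P w) (V \ N w) := by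
        intro U' hU'
        obtain ⟨h1, h2⟩ := Finset.mem_filter.1 hU'
        exact Finset.mem_Icc.2 (hr w hw U' (Finset.mem_powerset.1 h1) h2)
      have hcard := Finset.card_le_card hsub
      rw [Finset.card_Icc_finset (hPU.trans hUN), Finset.card_sdiff_of_subset (hN w)] at hcard
      have hPN := Finset.card_le_card (hPU.trans hUN)
      rw [Finset.card_sdiff_of_subset (hN w)] at hPN
      have hNV := Finset.card_le_card (hN w)
      refine (Nat.mul_le_mul_right _ hcard).trans ?_
      rw [← pow_add]
      exact Nat.pow_le_pow_right (by norm_num) (by omega)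
  have hall : 2 ^ V.card ≤ ∑ w ∈ 𝒲, (V.powerset.filter (r w)).card := by
    rw [← Finset.card_powerset]
    refine le_trans (Finset.card_le_card fun U hU => ?_) Finset.card_biUnion_le
    obtain ⟨w, hw, hrw⟩ := hcover U (Finset.mem_powerset.1 hU)
    exact Finset.mem_biUnion.2 ⟨w, hw, Finset.mem_filter.2 ⟨hU, hrw⟩⟩
  have hbound : 2 ^ V.card * 2 ^ s ≤ 𝒲.card * 2 ^ V.card := by
    calc 2 ^ V.card * 2 ^ s ≤ (∑ w ∈ 𝒲, (V.powerset.filter (r w)).card) * 2 ^ s :=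
          Nat.mul_le_mul_right _ hall
      _ = ∑ w ∈ 𝒲, (V.powerset.filter (r w)).card * 2 ^ s := Finset.sum_mul _ _ _
      _ ≤ 𝒲.card * 2 ^ V.card := by
          simpa using Finset.sum_le_sum hcount
  rw [mul_comm (2 ^ V.card)] at hbound
  exact absurd (Nat.le_of_mul_le_mul_right hbound (by positivity)) (by omega)

/-- If every Hall block contains one of the fewer than `2 ^ s` sets in `𝒲`, then few permutations
meet all sets in `𝒲`. A permutation is revealed one value at a time: given its values on `X`, some
set in `𝒲` leaves at most `s ^ 2` possibilities for a further edge. -/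
theorem card_perms_hitting_le {n s : ℕ} (𝒲 : Finset (Finset (PotentialEdge n)))
    (hs : 𝒲.card < 2 ^ s)
    (hHall : ∀ L₁ R₁ : Finset (Fin n), L₁.card + R₁.card = n + 1 → ∃ W ∈ 𝒲, W ⊆ L₁ ×ˢ R₁) :
    ∀ (k : ℕ) (X : Finset (Fin n)) (F : Finset (Perm (Fin n))), X.card + k = n →
      (∀ σ ∈ F, ∀ W ∈ 𝒲, ∃ i, (i, σ i) ∈ W) →
      (∀ σ ∈ F, ∀ τ ∈ F, ∀ x ∈ X, σ x = τ x) →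
      F.card ≤ (s ^ 2) ^ k := by
  intro k
  induction k with
  | zero =>
    intro X F hX _ hagree
    have hXuniv : X = Finset.univ := by
      rw [← Finset.card_eq_iff_eq_univ, Fintype.card_fin]
      omega
    rw [pow_zero, Finset.card_le_one]
    intro σ hσ τ hτ
    ext x
    rw [hagree σ hσ τ hτ x (by simp [hXuniv])]
  | succ k ih =>
    intro X F hX hhit hagree
    rcases F.eq_empty_or_nonempty with rfl | ⟨σ₀, hσ₀⟩
    · simp
    obtain ⟨a₀, ha₀⟩ : ∃ a, a ∉ X := by
      by_contra! h
      have : X = Finset.univ := Finset.eq_univ_iff_forall.2 h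
      rw [this, Finset.card_univ, Fintype.card_fin] at hX
      omega
    -- The free vertices are paired by `σ₀`; each `U ⊆ V` decides from which end of each pair
    -- the Hall block takes its vertex, and the pair at `a₀` contributes both.
    set V : Finset (Fin n) := Xᶜ.erase a₀ with hV
    have hVmem : ∀ a, a ∈ V ↔ a ≠ a₀ ∧ a ∉ X := by
      intro a
      simp [hV]
    have hVcard : V.card + X.card + 1 = n := by
      rw [hV, Finset.card_erase_of_mem (by simpa using ha₀), Finset.card_compl, Fintype.card_fin]
      omega
    set L₁ : Finset (Fin n) → Finset (Fin n) := fun U => insert a₀ (X ∪ U) with hL₁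
    set R₁ : Finset (Fin n) → Finset (Fin n) := fun U => (insert a₀ (V \ U)).image σ₀ with hR₁
    have hcard : ∀ U ⊆ V, (L₁ U).card + (R₁ U).card = n + 1 := by
      intro U hU
      have h1 : (L₁ U).card = X.card + U.card + 1 := by
        rw [hL₁, Finset.card_insert_of_notMem, Finset.card_union_of_disjoint]
        · rw [Finset.disjoint_right]
          exact fun a ha => ((hVmem a).1 (hU ha)).2
        · rw [Finset.mem_union, not_or]
          exact ⟨ha₀, fun h => ((hVmem a₀).1 (hU h)).1 rfl⟩
      have h2 : (R₁ U).card = V.card - U.card + 1 := by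
        rw [hR₁, Finset.card_image_of_injective _ σ₀.injective, Finset.card_insert_of_notMem,
          Finset.card_sdiff_of_subset hU]
        rw [Finset.mem_sdiff, not_and_or]
        exact Or.inl fun h => ((hVmem a₀).1 h).1 rfl
      have := Finset.card_le_card hU
      omega
    obtain ⟨W, hW, U, hUV, hWU, hnarrow⟩ := exists_narrow_of_cover (s := s) 𝒲 V
      (fun W => V.filter fun a => a ∈ W.image Prod.fst)
      (fun W => V.filter fun a => σ₀ a ∈ W.image Prod.snd)
      (fun W U => W ⊆ L₁ U ×ˢ R₁ U)
      (fun W => Finset.filter_subset _ _)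
      (by
        intro W _ U hU hWU
        constructor
        · intro a ha
          obtain ⟨haV, haW⟩ := Finset.mem_filter.1 ha
          obtain ⟨e, he, rfl⟩ := Finset.mem_image.1 haW
          have := (Finset.mem_product.1 (hWU he)).1
          rw [hVmem] at haV
          simpa [hL₁, haV.1, haV.2] using this
        · intro a ha
          refine Finset.mem_sdiff.2 ⟨hU ha, fun haN => ?_⟩
          obtain ⟨haV, haW⟩ := Finset.mem_filter.1 haN
          obtain ⟨e, he, hea⟩ := Finset.mem_image.1 haW
          have := (Finset.mem_product.1 (hWU he)).2
          rw [hea] at this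
          obtain ⟨a', ha', hσa⟩ := Finset.mem_image.1 this
          rw [σ₀.injective hσa] at ha'
          rw [hVmem] at haV
          simp [haV.1, ha] at ha')
      (fun U hU => hHall _ _ (hcard U hU)) hs
    set P := V.filter fun a => a ∈ W.image Prod.fst with hP
    set N := V.filter fun a => σ₀ a ∈ W.image Prod.snd with hN
    have hcandidates : (insert a₀ P ×ˢ (insert a₀ N).image σ₀).card ≤ s ^ 2 := by
      rw [Finset.card_product, sq]
      refine Nat.mul_le_mul ((Finset.card_insert_le _ _).trans ?_)
        (Finset.card_image_le.trans ((Finset.card_insert_le _ _).trans ?_))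
      · omega
      · omega
    have hsplit : F ⊆ (insert a₀ P ×ˢ (insert a₀ N).image σ₀).biUnion
        fun e => F.filter fun σ => σ e.1 = e.2 := by
      intro σ hσ
      obtain ⟨i, hi⟩ := hhit σ hσ W hW
      obtain ⟨hiL, hiR⟩ := Finset.mem_product.1 (hWU hi)
      obtain ⟨a, ha, haσ⟩ := Finset.mem_image.1 hiR
      -- The hit edge is new: `R₁ U` contains no image of a vertex in `X`.
      have hiX : i ∉ X := by
        intro hiX
        have : σ₀ a = σ₀ i := haσ.trans (hagree σ hσ σ₀ hσ₀ i hiX)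
        rw [σ₀.injective this] at ha
        rcases Finset.mem_insert.1 ha with h | h
        · exact ha₀ (h ▸ hiX)
        · exact ((hVmem i).1 (Finset.mem_sdiff.1 h).1).2 hiX
      refine Finset.mem_biUnion.2 ⟨(i, σ i), Finset.mem_product.2 ⟨?_, ?_⟩,
        Finset.mem_filter.2 ⟨hσ, rfl⟩⟩
      · by_cases hia : i = a₀
        · simp [hia]
        · exact Finset.mem_insert_of_mem (Finset.mem_filter.2
            ⟨(hVmem i).2 ⟨hia, hiX⟩, Finset.mem_image.2 ⟨_, hi, rfl⟩⟩)
      · refine Finset.mem_image.2 ⟨a, ?_, haσ⟩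
        rcases Finset.mem_insert.1 ha with h | h
        · simp [h]
        · exact Finset.mem_insert_of_mem (Finset.mem_filter.2
            ⟨(Finset.mem_sdiff.1 h).1, Finset.mem_image.2 ⟨_, hi, haσ.symm⟩⟩)
    refine (Finset.card_le_card hsplit).trans
      ((Finset.card_biUnion_le_card_mul _ _ ((s ^ 2) ^ k) ?_).trans ?_)
    · rintro ⟨a, b⟩ he
      have haX : a ∉ X := by
        rcases Finset.mem_insert.1 (Finset.mem_product.1 he).1 with h | h
        · exact fun haX => ha₀ ((show a = a₀ from h) ▸ haX)
        · exact ((hVmem a).1 (Finset.mem_filter.1 h).1).2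
      refine ih (insert a X) _ ?_ ?_ ?_
      · rw [Finset.card_insert_of_notMem haX]
        omega
      · exact fun σ hσ => hhit σ (Finset.mem_filter.1 hσ).1
      · intro σ hσ τ hτ x hx
        obtain ⟨hσF, hσa⟩ := Finset.mem_filter.1 hσ
        obtain ⟨hτF, hτa⟩ := Finset.mem_filter.1 hτ
        rcases Finset.mem_insert.1 hx with rfl | hx
        · exact hσa.trans hτa.symm
        · exact hagree σ hσF τ hτF x hx
    · rw [pow_succ' (s ^ 2) k]
      exact Nat.mul_le_mul_right _ hcandidates

/-! ### OR-queries -/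

/-- The graph whose only edges are those of the perfect matching `i ↦ σ i`. -/
def permGraph {n : ℕ} (σ : Perm (Fin n)) : Finset (PotentialEdge n) :=
  Finset.univ.image fun i => (i, σ i)

theorem mem_permGraph {n : ℕ} {σ : Perm (Fin n)} {e : PotentialEdge n} :
    e ∈ permGraph σ ↔ σ e.1 = e.2 := by
  obtain ⟨a, b⟩ := e
  simp [permGraph]

theorem permGraph_injective {n : ℕ} :
    Function.Injective (permGraph : Perm (Fin n) → Finset (PotentialEdge n)) := by
  intro σ τ h
  ext i
  have : (i, σ i) ∈ permGraph τ := h ▸ mem_permGraph.2 rfl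
  rw [mem_permGraph.1 this]

theorem orQuery_eq_true_iff {n : ℕ} {S E : Finset (PotentialEdge n)} :
    orQuery n S E = true ↔ ∃ e ∈ S, e ∈ E := by
  simp [orQuery, Finset.Nonempty]

/-- A leaf of a correct tree is reached by few perfect matchings. -/
theorem card_perms_agree_le {n d s : ℕ} {A : QueryAlg n} (hA : A.SolvesBPM orQuery)
    (hd : ∀ E, A.numQueries orQuery E ≤ d) (hs : d < 2 ^ s) (σ₀ : Perm (Fin n)) :
    (Finset.univ.filter fun σ : Perm (Fin n) => ∀ S ∈ A.asked orQuery (permGraph σ₀),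
      orQuery n S (permGraph σ) = orQuery n S (permGraph σ₀)).card ≤ (s ^ 2) ^ n := by
  classical
  set l := A.asked orQuery (permGraph σ₀) with hl
  -- `Z` is the set of potential edges known to be absent.
  set Z : Finset (PotentialEdge n) := Finset.univ.filter fun e =>
    ∃ S ∈ l, orQuery n S (permGraph σ₀) = false ∧ e ∈ S with hZ
  set 𝒲 : Finset (Finset (PotentialEdge n)) :=
    (l.toFinset.filter fun S => orQuery n S (permGraph σ₀) = true).image fun S => S \ Z with h𝒲
  have hcard : 𝒲.card < 2 ^ s := by
    refine lt_of_le_of_lt ?_ hs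
    refine Finset.card_image_le.trans ((Finset.card_filter_le _ _).trans
      ((List.toFinset_card_le _).trans ?_))
    rw [hl, QueryAlg.length_asked]
    exact hd _
  refine card_perms_hitting_le 𝒲 hcard ?_ n ∅ _ (by simp) ?_ (by simp)
  · intro L₁ R₁ hLR
    by_contra! hnone
    -- Otherwise the largest graph avoiding both `Z` and the block reaches the same leaf.
    set E : Finset (PotentialEdge n) := (L₁ ×ˢ R₁ ∪ Z)ᶜ with hE
    have hnot : ¬ HasBPM E := by
      refine not_hasBPM_of_disjoint_product hLR fun e he he' => ?_
      rw [hE, Finset.mem_compl, Finset.mem_union, not_or] at he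
      exact he.1 he'
    have hrun : A.run orQuery E = A.run orQuery (permGraph σ₀) := by
      refine A.run_eq_of_agree fun S hS => ?_
      cases hans : orQuery n S (permGraph σ₀) with
      | true =>
        have hmem : S \ Z ∈ 𝒲 := Finset.mem_image.2
          ⟨S, Finset.mem_filter.2 ⟨List.mem_toFinset.2 hS, hans⟩, rfl⟩
        obtain ⟨e, he, he'⟩ := Finset.not_subset.1 (hnone _ hmem)
        obtain ⟨heS, heZ⟩ := Finset.mem_sdiff.1 he
        refine orQuery_eq_true_iff.2 ⟨e, heS, ?_⟩
        rw [hE, Finset.mem_compl, Finset.mem_union, not_or]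
        exact ⟨he', heZ⟩
      | false =>
        rw [← Bool.not_eq_true, orQuery_eq_true_iff]
        rintro ⟨e, heS, heE⟩
        rw [hE, Finset.mem_compl, Finset.mem_union, not_or] at heE
        exact heE.2 (Finset.mem_filter.2 ⟨Finset.mem_univ _, S, hS, hans, heS⟩)
    have hyes : A.run orQuery (permGraph σ₀) = true :=
      (hA _).2 ((hasBPM_iff_exists_perm _).2 ⟨σ₀, fun i => mem_permGraph.2 rfl⟩)
    exact hnot ((hA _).1 (hrun.trans hyes))
  · intro σ hσ W hW
    have hagree := (Finset.mem_filter.1 hσ).2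
    obtain ⟨S, hS, rfl⟩ := Finset.mem_image.1 hW
    obtain ⟨hSl, hans⟩ := Finset.mem_filter.1 hS
    rw [List.mem_toFinset] at hSl
    obtain ⟨⟨i, j⟩, heS, heσ⟩ := orQuery_eq_true_iff.1 ((hagree S hSl).trans hans)
    obtain rfl : σ i = j := mem_permGraph.1 heσ
    refine ⟨i, Finset.mem_sdiff.2 ⟨heS, fun heZ => ?_⟩⟩
    obtain ⟨-, T, hT, hTans, heT⟩ := Finset.mem_filter.1 heZ
    have := hagree T hT
    rw [hTans, orQuery_eq_true_iff.2 ⟨_, heT, heσ⟩] at this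
    exact absurd this (by simp)

theorem factorial_le_of_solvesBPM_orQuery {n d s : ℕ} {A : QueryAlg n}
    (hA : A.SolvesBPM orQuery) (hd : ∀ E, A.numQueries orQuery E ≤ d) (hs : d < 2 ^ s) :
    n.factorial ≤ 2 ^ d * (s ^ 2) ^ n := by
  classical
  have h := A.card_le_two_pow_mul orQuery ((s ^ 2) ^ n) d
    (Finset.univ.image (permGraph : Perm (Fin n) → _)) (fun E _ => hd E) ?_
  · rwa [Finset.card_image_of_injective _ permGraph_injective, Finset.card_univ,
      Fintype.card_perm, Fintype.card_fin] at h
  · intro E₀ hE₀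
    obtain ⟨σ₀, -, rfl⟩ := Finset.mem_image.1 hE₀
    rw [Finset.filter_image]
    exact Finset.card_image_le.trans (card_perms_agree_le hA hd hs σ₀)

theorem eventually_exists_le_numQueries_orQuery :
    ∀ᶠ n : ℕ in atTop, ∀ A : QueryAlg n, A.SolvesBPM orQuery →
      ∃ E : Finset (PotentialEdge n),
        (1 / 4 : ℝ) * ((n : ℝ) * Real.log n) ≤ (A.numQueries orQuery E : ℝ) := by
  have hlog : Tendsto (fun n : ℕ => Real.log n) atTop atTop :=
    Real.tendsto_log_atTop.comp tendsto_natCast_atTop_atTop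
  have hsmall : ∀ᶠ x : ℝ in atTop, 2 * Real.log (5 * x) + 1 < 3 / 4 * x := by
    have h1 : ∀ᶠ x : ℝ in atTop, ‖Real.log x‖ ≤ 1 / 8 * ‖x‖ :=
      Real.isLittleO_log_id_atTop.def (by norm_num)
    filter_upwards [h1, eventually_gt_atTop (4 * Real.log 5 + 2), eventually_gt_atTop 0]
      with x hx hx5 hx0
    rw [Real.norm_of_nonneg hx0.le] at hx
    have := (Real.le_norm_self _).trans hx
    rw [Real.log_mul (by norm_num) hx0.ne']
    linarith
  filter_upwards [hlog.eventually hsmall, hlog.eventually_ge_atTop 1, eventually_ge_atTop 1]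
    with n hn hn1 hnpos A hA
  by_contra! hlt
  set x := Real.log n with hx
  have hn0 : (0 : ℝ) < n := by exact_mod_cast hnpos
  set d := ⌊(1 / 4 : ℝ) * (n * x)⌋₊ with hd
  have hd_le : (d : ℝ) ≤ 1 / 4 * (n * x) := Nat.floor_le (by positivity)
  -- The width `s` is logarithmic in `n`, yet `2 ^ s` exceeds `n ^ 2 > d`.
  set s := ⌈4 * x⌉₊ with hs
  have hs_ge : 4 * x ≤ s := Nat.le_ceil _
  have hs_le : (s : ℝ) ≤ 5 * x := by
    have := Nat.ceil_lt_add_one (show 0 ≤ 4 * x by linarith)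
    linarith
  have hs0 : (0 : ℝ) < s := by linarith
  have hds : d < 2 ^ s := by
    have hx_lt : x < n := (Real.log_le_sub_one_of_pos hn0).trans_lt (sub_one_lt _)
    have h1 : (d : ℝ) < (n : ℝ) ^ 2 := by nlinarith
    have h2 : (n : ℝ) ^ 2 ≤ 2 ^ s := by
      rw [← Real.log_le_log_iff (by positivity) (by positivity), Real.log_pow, Real.log_pow, ← hx]
      have := Real.log_two_gt_d9
      push_cast
      nlinarith
    exact_mod_cast h1.trans_le h2
  have hfact := factorial_le_of_solvesBPM_orQuery hA
    (fun E => Nat.le_floor (hlt E).le) hds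
  have hfact' : (n.factorial : ℝ) ≤ 2 ^ d * ((s : ℝ) ^ 2) ^ n := by exact_mod_cast hfact
  have hlogfact : n * x - n ≤ Real.log n.factorial := by
    have h := Real.pow_div_factorial_le_exp (n : ℝ) hn0.le n
    have hpos : (0 : ℝ) < n.factorial := by exact_mod_cast n.factorial_pos
    have := Real.log_le_log (by positivity) h
    rw [Real.log_exp, Real.log_div (by positivity) hpos.ne', Real.log_pow] at this
    linarith
  have hlogle := Real.log_le_log (by exact_mod_cast n.factorial_pos) hfact'
  rw [Real.log_mul (by positivity) (by positivity), Real.log_pow, Real.log_pow, Real.log_pow]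
    at hlogle
  have hlogs : Real.log s ≤ Real.log (5 * x) := Real.log_le_log hs0 hs_le
  have hd2 : d * Real.log 2 ≤ 1 / 4 * (n * x) := by
    have h2 : Real.log 2 ≤ 1 := by
      have := Real.log_two_lt_d9
      linarith
    exact (mul_le_of_le_one_right (by positivity) h2).trans hd_le
  have hmul := mul_lt_mul_of_pos_left hn hn0
  have hmul' := mul_le_mul_of_nonneg_left hlogs hn0.le
  push_cast at hlogle
  nlinarith

/-! ### Lower bounds in the three query models -/

theorem mainTheorem2 :
    -- deterministic OR-queries: `Ω(n log n)`
    (∃ c : ℝ, 0 < c ∧ ∀ᶠ n : ℕ in atTop, ∀ A : QueryAlg n, A.SolvesBPM orQuery →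
      ∃ E : Finset (PotentialEdge n),
        c * ((n : ℝ) * Real.log n) ≤ (A.numQueries orQuery E : ℝ)) ∧
    -- deterministic AND-queries: `Ω(n ^ 2)`
    (∃ c : ℝ, 0 < c ∧ ∀ᶠ n : ℕ in atTop, ∀ A : QueryAlg n, A.SolvesBPM andQuery →
      ∃ E : Finset (PotentialEdge n),
        c * (n : ℝ) ^ 2 ≤ (A.numQueries andQuery E : ℝ)) ∧
    -- randomized AND-queries, any constant error below one half: `Ω(n ^ 2)`
    (∀ ε : ℝ, 0 ≤ ε → ε < 1 / 2 →
      ∃ c : ℝ, 0 < c ∧ ∀ᶠ n : ℕ in atTop, ∀ A : RandQueryAlg n,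
        RandQueryAlg.SolvesBPMWithError andQuery ε A →
        ∃ E : Finset (PotentialEdge n),
          ENNReal.ofReal (c * (n : ℝ) ^ 2) ≤ RandQueryAlg.expectedQueries andQuery A E) ∧
    -- deterministic XOR-queries: `Ω(n ^ 2)`
    (∃ c : ℝ, 0 < c ∧ ∀ᶠ n : ℕ in atTop, ∀ A : QueryAlg n, A.SolvesBPM xorQuery →
      ∃ E : Finset (PotentialEdge n),
        c * (n : ℝ) ^ 2 ≤ (A.numQueries xorQuery E : ℝ)) := by
  refine ⟨⟨1 / 4, by norm_num, eventually_exists_le_numQueries_orQuery⟩, ⟨1 / 4, by norm_num, ?_⟩,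
    fun ε hε0 hε => ⟨(1 - 2 * ε) / 4, by linarith, ?_⟩, ⟨1 / 4, by norm_num, ?_⟩⟩
  · filter_upwards [eventually_ge_atTop 1] with n hn A hA
    obtain ⟨m, hm⟩ := exists_large_hallBlock hn
    exact ⟨(hallBlock m)ᶜ, hm.trans (by exact_mod_cast card_hallBlock_le_numQueries_andQuery m hA)⟩
  · filter_upwards [eventually_ge_atTop 1] with n hn A hA
    obtain ⟨m, hm⟩ := exists_large_hallBlock hn
    refine ⟨(hallBlock m)ᶜ, le_trans (ENNReal.ofReal_le_ofReal ?_)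
      (card_hallBlock_le_expectedQueries_andQuery m hε0 hA)⟩
    have := mul_le_mul_of_nonneg_left hm (show 0 ≤ 1 - 2 * ε by linarith)
    linarith
  · filter_upwards [eventually_ge_atTop 1] with n hn A hA
    obtain ⟨m, hm⟩ := exists_large_hallBlock hn
    exact ⟨(hallBlock m)ᶜ, hm.trans (by exact_mod_cast card_hallBlock_le_numQueries_xorQuery m hA)⟩
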